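/- A continuous lattice is a complete lattice $L$ in which every $x$ is the supremum of the (automatically directed) set $\{d\in L: d\ll x\}$, where $d\ll x$ means that every nonempty directed $D\subseteq L$ with $x\le\bigvee D$ contains an element $e$ with $d\le e$. For a poset $P$, let $\sigma(P)$ be the Scott topology (its closed sets are the lower sets that contain the supremum, whenever it exists in $P$, of each of their nonempty directed subsets), let $\upsilon(P)$ be the upper topology, generated by the subbase $\{P\setminus{\downarrow}x : x\in P\}$, and let $P^{op}$ be $P$ with the reversed order. $L$ and $L^{op}$ have the same underlying set. Let $L$ be a continuous lattice. The following conditions are equivalent: 1. $\sigma(L^{op})=\upsilon(L^{op})$. 2. The bi-Scott topology $\sigma(L)\vee\sigma(L^{op})$ on $L$, that is, the coarsest topology containing both $\sigma(L)$ and $\sigma(L^{op})$, is compact and Hausdorff. 3. Let $Q(L)$ be the set of all subsets of $L$ (including $\emptyset$) that are upper sets and are compact in the Scott topology $\sigma(L)$, ordered by reverse inclusion. Then the lattice $\sigma(L^{op})$ of open sets, ordered by inclusion, is order-isomorphic to $Q(L)$. -/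

import Mathlib

namespace BiScott

/-- The way-below relation `x ≪ y` on a poset. -/
def WayBelow {P : Type*} [PartialOrder P] (x y : P) : Prop :=
  ∀ D : Set P, D.Nonempty → DirectedOn (· ≤ ·) D →
    ∀ s : P, IsLUB D s → y ≤ s → ∃ d ∈ D, x ≤ d

/-- A poset is continuous if for every `x` the set of elements way below `x` is directed
(in particular nonempty) and has supremum `x`. A continuous lattice is a complete lattice
which is continuous as a poset. -/
def IsContinuousPoset (P : Type*) [PartialOrder P] : Prop :=
  ∀ x : P, {d : P | WayBelow d x}.Nonempty ∧
    DirectedOn (· ≤ ·) {d : P | WayBelow d x} ∧ IsLUB {d : P | WayBelow d x} x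

/-- The Scott topology `σ(P)`. -/
abbrev scottTopology (P : Type*) [PartialOrder P] : TopologicalSpace P :=
  Topology.scott P Set.univ

/-- The upper topology `υ(P)`, generated by the complements of the principal ideals. -/
abbrev upperTopology (P : Type*) [PartialOrder P] : TopologicalSpace P :=
  Topology.upper P

/-- The bi-Scott topology `σ(P) ∨ σ(Pᵒᵖ)` on `P`: the coarsest topology containing all Scott open
sets of `P` and all Scott open sets of the opposite poset. Mathlib orders topologies by reverse
inclusion of open sets, so this join is written `⊓`. -/
abbrev biScottTopology (P : Type*) [PartialOrder P] : TopologicalSpace P :=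
  scottTopology P ⊓ (scottTopology Pᵒᵈ).induced OrderDual.toDual

/-- The lattice `σ(P)` of Scott open sets, ordered by inclusion. -/
abbrev ScottOpens (P : Type*) [PartialOrder P] : Type _ :=
  @TopologicalSpace.Opens P (scottTopology P)

/-- `Q(P)`: the saturated (that is, upper) subsets of `P` which are compact in the Scott topology
(the empty set included), ordered by reverse inclusion. -/
abbrev ScottCompactSaturated (P : Type*) [PartialOrder P] : Type _ :=
  {K : Set P // @IsCompact P (scottTopology P) K ∧ IsUpperSet K}ᵒᵈ

end BiScott

namespace BiScott

open Set Filter Topology TopologicalSpace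

/-! For continuous L the Lawson topology, the join of σ(L) and the lower topology, is compact
Hausdorff, and the lower-closed sets are exactly the Scott compact upper sets
(`isClosed_lower_iff`). Complementation thus always gives υ(Lᵒᵖ) ≅ Q(L), hence 1 → 3. Under 1 the
bi-Scott topology is the Lawson topology, hence 2. Conversely, a compact topology finer than a
Hausdorff one equals it, so Scott closed sets of Lᵒᵖ are Lawson closed upper sets of L, and these
are lower-closed.

Given 3, the lattices σ(Lᵒᵖ) and υ(Lᵒᵖ) are isomorphic. Both topologies are sober; for σ(Lᵒᵖ) this
is the delicate point, and it follows from continuity of the lattice υ(Lᵒᵖ), transported along the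
isomorphism. The isomorphism is then induced by an order automorphism of Lᵒᵖ, which preserves the
upper topology, so the two topologies coincide. -/

theorem isOpen_scott_iff {P : Type*} [PartialOrder P] {s : Set P} :
    IsOpen[scottTopology P] s ↔ IsUpperSet s ∧ DirSupInacc s := by
  let _ := scottTopology P
  have : IsScott P univ := ⟨rfl⟩
  rw [IsScott.isOpen_iff_isUpperSet_and_dirSupInaccOn (D := univ), dirSupInaccOn_univ]

theorem scott_le_upper (P : Type*) [PartialOrder P] : scottTopology P ≤ upperTopology P := by
  refine le_generateFrom ?_
  rintro _ ⟨a, rfl⟩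
  let _ := scottTopology P
  have : IsScott P univ := ⟨rfl⟩
  exact isClosed_Iic.isOpen_compl

/-! ### The way-below relation and interpolation -/

section WayBelow

variable {L : Type*} [CompleteLattice L]

theorem WayBelow.trans_le {x y z : L} (h : WayBelow x y) (hyz : y ≤ z) : WayBelow x z :=
  fun D hD hd s hs hz ↦ h D hD hd s hs (hyz.trans hz)

theorem WayBelow.le {x y : L} (h : WayBelow x y) : x ≤ y := by
  obtain ⟨d, rfl, hd⟩ := h {y} (singleton_nonempty y) (directedOn_singleton y)
    y isLUB_singleton le_rfl
  exact hd

theorem WayBelow.sup {x y z : L} (hx : WayBelow x z) (hy : WayBelow y z) :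
    WayBelow (x ⊔ y) z := by
  intro D hD hd s hs hz
  obtain ⟨a, ha, hxa⟩ := hx D hD hd s hs hz
  obtain ⟨b, hb, hyb⟩ := hy D hD hd s hs hz
  obtain ⟨c, hc, hac, hbc⟩ := hd a ha b hb
  exact ⟨c, hc, sup_le (hxa.trans hac) (hyb.trans hbc)⟩

theorem IsContinuousPoset.exists_wayBelow_not_le (hL : IsContinuousPoset L) {x y : L}
    (h : ¬ x ≤ y) : ∃ d, WayBelow d x ∧ ¬ d ≤ y := by
  by_contra! H
  exact h ((hL x).2.2.2 fun d hd ↦ H d hd)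

theorem IsContinuousPoset.isOpen_wayAbove (hL : IsContinuousPoset L) (d : L) :
    IsOpen[scottTopology L] {y | WayBelow d y} := by
  refine isOpen_scott_iff.2 ⟨fun a b hab ha ↦ WayBelow.trans_le ha hab, ?_⟩
  intro D hD hdir s hs hds
  -- Interpolation: `E` is directed with the same supremum as `D`, so `d` lies below some `z` that
  -- is way below a member of `D`.
  let E : Set L := {z | ∃ e ∈ D, WayBelow z e}
  have hEn : E.Nonempty := by
    obtain ⟨e, he⟩ := hD
    obtain ⟨z, hz⟩ := (hL e).1
    exact ⟨z, e, he, hz⟩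
  have hEd : DirectedOn (· ≤ ·) E := by
    rintro a ⟨e, he, hae⟩ b ⟨e', he', hbe⟩
    obtain ⟨c, hc, hec, hec'⟩ := hdir e he e' he'
    exact ⟨a ⊔ b, ⟨c, hc, (hae.trans_le hec).sup (hbe.trans_le hec')⟩, le_sup_left, le_sup_right⟩
  have hE : IsLUB E s := by
    refine ⟨?_, fun u hu ↦ hs.2 fun e he ↦ (hL e).2.2.2 fun z hz ↦ hu ⟨e, he, hz⟩⟩
    rintro z ⟨e, he, hze⟩
    exact hze.le.trans (hs.1 he)
  obtain ⟨z, ⟨e, he, hze⟩, hdz⟩ := hds E hEn hEd s hE le_rfl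
  exact ⟨e, he, fun D' h1 h2 t ht het ↦ by
    obtain ⟨k, hk, hzk⟩ := hze D' h1 h2 t ht het
    exact ⟨k, hk, hdz.trans hzk⟩⟩

end WayBelow

/-! ### The Lawson topology and Scott compact upper sets -/

section Lawson

variable {L : Type*} [CompleteLattice L]

/-- The Lawson topology: the join of the Scott topology and the lower topology. -/
abbrev lawsonTopology (L : Type*) [PartialOrder L] : TopologicalSpace L :=
  scottTopology L ⊓ Topology.lower L

theorem isOpen_lower_compl_Ici (a : L) : IsOpen[Topology.lower L] (Ici a)ᶜ :=
  isOpen_generateFrom_of_mem ⟨a, rfl⟩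

theorem compactSpace_lawson (L : Type*) [CompleteLattice L] :
    @CompactSpace L (lawsonTopology L) := by
  refine @CompactSpace.mk L (lawsonTopology L) ?_
  rw [@isCompact_iff_ultrafilter_le_nhds L (lawsonTopology L)]
  intro f _
  -- The ultrafilter converges to its limit inferior, the directed supremum of the infima of its
  -- members.
  let D : Set L := sInf '' {s : Set L | s ∈ f}
  have hDn : D.Nonempty := ⟨_, univ, univ_mem, rfl⟩
  have hDd : DirectedOn (· ≤ ·) D := by
    rintro _ ⟨s, hs, rfl⟩ _ ⟨t, ht, rfl⟩
    exact ⟨_, ⟨s ∩ t, inter_mem hs ht, rfl⟩, sInf_le_sInf inter_subset_left,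
      sInf_le_sInf inter_subset_right⟩
  refine ⟨sSup D, mem_univ _, ?_⟩
  rw [nhds_inf (t₁ := scottTopology L), le_inf_iff]
  constructor
  · rw [@le_nhds_iff L (scottTopology L)]
    intro U hx hU
    obtain ⟨hup, hin⟩ := isOpen_scott_iff.1 hU
    obtain ⟨_, ⟨s, hs, rfl⟩, hsU⟩ := hin hDn hDd (isLUB_sSup D) hx
    exact mem_of_superset hs fun y hy ↦ hup (sInf_le hy) hsU
  · rw [nhds_generateFrom]
    simp only [le_iInf_iff, le_principal_iff]
    rintro _ ⟨hx, a, rfl⟩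
    refine Ultrafilter.compl_mem_iff_notMem.2 fun ha ↦ hx ?_
    exact (le_sInf fun y hy ↦ hy).trans (le_sSup ⟨Ici a, ha, rfl⟩)

theorem IsContinuousPoset.t2Space_lawson (hL : IsContinuousPoset L) :
    @T2Space L (lawsonTopology L) := by
  have key : ∀ x y : L, ¬ x ≤ y → ∃ u v : Set L, IsOpen[lawsonTopology L] u ∧
      IsOpen[lawsonTopology L] v ∧ x ∈ u ∧ y ∈ v ∧ Disjoint u v := by
    intro x y h
    obtain ⟨d, hdx, hdy⟩ := hL.exists_wayBelow_not_le h
    refine ⟨{z | WayBelow d z}, (Ici d)ᶜ, (inf_le_left : lawsonTopology L ≤ _) _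
      (hL.isOpen_wayAbove d), (inf_le_right : lawsonTopology L ≤ _) _ (isOpen_lower_compl_Ici d),
      hdx, hdy, disjoint_left.2 fun z hz hz' ↦ hz' (WayBelow.le hz)⟩
  refine @T2Space.mk L (lawsonTopology L) fun x y hxy ↦ ?_
  by_cases h : x ≤ y
  · obtain ⟨u, v, hu, hv, hy, hx, huv⟩ := key y x fun h' ↦ hxy (h.antisymm h')
    exact ⟨v, u, hv, hu, hx, hy, huv.symm⟩
  · exact key x y h

/-- A Scott compact upper set and a point outside it are separated by the way-above sets and the
upper closure of a finite set. -/
theorem IsContinuousPoset.exists_separation (hL : IsContinuousPoset L) {K : Set L}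
    (hK : @IsCompact L (scottTopology L) K) (hup : IsUpperSet K) {x : L} (hx : x ∉ K) :
    ∃ V U : Set L, IsOpen[Topology.lower L] V ∧ IsOpen[scottTopology L] U ∧ x ∈ V ∧
      Disjoint V U ∧ K ⊆ U := by
  obtain ⟨F, hF, hFf, hKF⟩ := @IsCompact.elim_finite_subcover_image L L (scottTopology L) K
    {d | ¬ d ≤ x} (fun d ↦ {z | WayBelow d z}) hK (fun d _ ↦ hL.isOpen_wayAbove d) (by
      intro k hk
      obtain ⟨d, hd, hdx⟩ := hL.exists_wayBelow_not_le fun hkx : k ≤ x ↦ hx (hup hkx hk)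
      exact mem_biUnion (x := d) hdx hd)
  refine ⟨⋂ d ∈ F, (Ici d)ᶜ, ⋃ d ∈ F, {z | WayBelow d z}, ?_, ?_, ?_, ?_, hKF⟩
  · exact @Finite.isOpen_biInter L L (Topology.lower L) F _ hFf fun d _ ↦ isOpen_lower_compl_Ici d
  · exact @isOpen_biUnion L L (scottTopology L) F _ fun d _ ↦ hL.isOpen_wayAbove d
  · exact mem_iInter₂.2 fun d hd ↦ hF hd
  · refine disjoint_left.2 fun z hz hz' ↦ ?_
    obtain ⟨d, hd, hdz⟩ := mem_iUnion₂.1 hz'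
    exact mem_iInter₂.1 hz d hd (WayBelow.le hdz)

theorem isCompact_scott_of_isClosed_lawson {K : Set L}
    (hK : IsClosed[lawsonTopology L] K) : @IsCompact L (scottTopology L) K := by
  have h : @IsCompact L (lawsonTopology L) K :=
    @IsClosed.isCompact L (lawsonTopology L) K (compactSpace_lawson L) hK
  have := @IsCompact.image L L (lawsonTopology L) (scottTopology L) K id h
    (continuous_id_iff_le.2 inf_le_left)
  rwa [image_id] at this

theorem IsContinuousPoset.isClosed_lower_iff (hL : IsContinuousPoset L) {K : Set L} :
    IsClosed[Topology.lower L] K ↔ @IsCompact L (scottTopology L) K ∧ IsUpperSet K := by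
  constructor
  · intro h
    refine ⟨isCompact_scott_of_isClosed_lawson (h.mono inf_le_right), ?_⟩
    let _ := Topology.lower L
    have : IsLower L := ⟨rfl⟩
    exact IsLower.isUpperSet_of_isClosed h
  · rintro ⟨hK, hup⟩
    rw [← @isOpen_compl_iff L _ (Topology.lower L), @isOpen_iff_forall_mem_open L (Topology.lower L)]
    intro x hx
    obtain ⟨V, U, hV, -, hxV, hVU, hKU⟩ := hL.exists_separation hK hup hx
    exact ⟨V, fun y hy hyK ↦ disjoint_left.1 hVU hy (hKU hyK), hV, hxV⟩

end Lawson

/-! ### Sobriety of the Scott and upper topologies -/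

section Sober

/-- In a complete lattice whose lattice of Scott open sets is continuous, prime Scott open sets are
the complements of principal ideals. Continuity is expressed by Scott open families of open sets. -/
theorem exists_eq_compl_Iic_of_infPrime_scott {M : Type*} [CompleteLattice M] [TopologicalSpace M]
    [IsScott M univ]
    (h : ∀ O : Opens M, ∀ b ∈ O, ∃ V : Opens M, b ∈ V ∧ ∃ H : Set (Opens M), O ∈ H ∧
      (∀ O' ∈ H, V ≤ O') ∧ IsUpperSet H ∧ DirSupInacc H)
    {p : Opens M} (hp : InfPrime p) : ∃ x, (p : Set M) = (Iic x)ᶜ := by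
  have scott_iff : ∀ s : Set M, IsOpen s ↔ IsUpperSet s ∧ DirSupInacc s := fun s ↦ by
    rw [IsScott.isOpen_iff_isUpperSet_and_dirSupInaccOn (D := univ), dirSupInaccOn_univ]
  obtain ⟨pup, pin⟩ := (scott_iff p).1 p.isOpen
  let T : M → Opens M := fun x ↦ ⟨{y | x ⊔ y ∈ p}, (scott_iff _).2
    ⟨fun a b hab ha ↦ pup (sup_le_sup_left hab x) ha, fun D hD hd s hs hxs ↦ by
      have hlub : IsLUB ((x ⊔ ·) '' D) (x ⊔ s) := by
        refine ⟨?_, fun u hu ↦ sup_le ?_ (hs.2 fun d hd ↦ le_sup_right.trans (hu ⟨d, hd, rfl⟩))⟩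
        · rintro _ ⟨d, hd, rfl⟩
          exact sup_le_sup_left (hs.1 hd) x
        · obtain ⟨d, hd⟩ := hD
          exact le_sup_left.trans (hu ⟨d, hd, rfl⟩)
      obtain ⟨_, ⟨d, hdD, rfl⟩, hdp⟩ := pin (hD.image _)
        (directedOn_image.2 (hd.mono' fun _ _ _ _ hab ↦ sup_le_sup_left hab x)) hlub hxs
      exact ⟨d, hdD, hdp⟩⟩⟩
  have Tmono : Monotone T := fun a b hab y hy ↦ pup (sup_le_sup_right hab y) hy
  have Tlub : ∀ {D : Set M} {s : M}, D.Nonempty → DirectedOn (· ≤ ·) D → IsLUB D s →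
      IsLUB (T '' D) (T s) := by
    intro D s hD hd hs
    refine ⟨?_, fun u hu y hy ↦ ?_⟩
    · rintro _ ⟨d, hd, rfl⟩
      exact Tmono (hs.1 hd)
    · have hy' : s ∈ T y := by
        change y ⊔ s ∈ p
        rw [sup_comm]
        exact hy
      obtain ⟨d, hdD, hdy⟩ := ((scott_iff _).1 (T y).isOpen).2 hD hd hs hy'
      refine hu ⟨d, hdD, rfl⟩ ?_
      change d ⊔ y ∈ p
      rw [sup_comm]
      exact hdy
  -- Binary join is only separately Scott continuous in general. The family `H` supplies the missing
  -- joint continuity: `W ×ˢ V` is a neighbourhood of `(a, b)` that join maps into `p`. Restricting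
  -- to the diagonal gives `W ⊓ V ≤ p`, and primality applies.
  have closed_sup : ∀ a ∉ p, ∀ b ∉ p, a ⊔ b ∉ p := by
    intro a ha b hb hab
    obtain ⟨V, hbV, H, hH, hVH, Hup, Hin⟩ := h (T a) b hab
    let W : Opens M := ⟨T ⁻¹' H, (scott_iff _).2 ⟨fun x y hxy hx ↦ Hup (Tmono hxy) hx,
      fun D hD hd s hs hTs ↦ by
        obtain ⟨_, ⟨d, hdD, rfl⟩, hdH⟩ := Hin (hD.image T)
          (directedOn_image.2 (hd.mono' fun _ _ _ _ hab ↦ Tmono hab)) (Tlub hD hd hs) hTs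
        exact ⟨d, hdD, hdH⟩⟩⟩
    have hWV : W ⊓ V ≤ p := by
      rintro c ⟨hcW, hcV⟩
      have : c ⊔ c ∈ p := hVH _ hcW hcV
      rwa [sup_idem] at this
    rcases hp.2 hWV with hW | hV
    · exact ha (hW hH)
    · exact hb (hV hbV)
  have hne : ((p : Set M)ᶜ).Nonempty := by
    rw [nonempty_compl]
    intro hu
    exact hp.1 (isMax_iff_eq_top.2 (Opens.ext hu))
  have hdir : DirectedOn (· ≤ ·) (p : Set M)ᶜ := fun a ha b hb ↦
    ⟨a ⊔ b, closed_sup a ha b hb, le_sup_left, le_sup_right⟩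
  have hmem : sSup (p : Set M)ᶜ ∉ p := fun hs ↦ by
    obtain ⟨x, hx, hxp⟩ := pin hne hdir (isLUB_sSup _) hs
    exact hx hxp
  refine ⟨sSup (p : Set M)ᶜ, Set.ext fun y ↦ ⟨fun hy hle ↦ hmem (pup hle hy), fun hy ↦ ?_⟩⟩
  by_contra hyp
  exact hy (le_sSup hyp)

/-- If `p` contained the supremum of its complement, a basic neighbourhood, the complement of
finitely many principal ideals, would lie in `p`. Primality selects one ideal containing the
complement of `p`, hence also that supremum: a contradiction. -/
theorem exists_eq_compl_Iic_of_infPrime_upper {M : Type*} [CompleteLattice M] [TopologicalSpace M]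
    [IsUpper M] {p : Opens M} (hp : InfPrime p) : ∃ x, (p : Set M) = (Iic x)ᶜ := by
  have hmem : sSup (p : Set M)ᶜ ∉ p := by
    intro hs
    obtain ⟨_, ⟨F, hF, rfl⟩, hsF, hFp⟩ :=
      IsUpper.isTopologicalBasis.exists_subset_of_mem_open hs p.isOpen
    have key : ∀ F : Set M, F.Finite → (lowerClosure F : Set M)ᶜ ⊆ p →
        ∃ a ∈ F, (p : Set M)ᶜ ⊆ Iic a := by
      intro F hF
      induction F, hF using Set.Finite.induction_on with
      | empty =>
        intro hFp
        exact absurd (isMax_iff_eq_top.2 (Opens.ext (univ_subset_iff.1 (by simpa using hFp)))) hp.1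
      | @insert a s _ hs ih =>
        intro hFp
        have hle : (⟨(Iic a)ᶜ, isClosed_Iic.isOpen_compl⟩ : Opens M) ⊓
            ⟨(lowerClosure s : Set M)ᶜ, (IsUpper.isClosed_lowerClosure hs).isOpen_compl⟩ ≤ p := by
          rintro y ⟨hya, hys⟩
          refine hFp fun hy ↦ ?_
          obtain ⟨b, rfl | hb, hyb⟩ := hy
          · exact hya hyb
          · exact hys ⟨b, hb, hyb⟩
        rcases hp.2 hle with h | h
        · exact ⟨a, mem_insert a s, compl_subset_comm.1 h⟩
        · obtain ⟨b, hb, hpb⟩ := ih h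
          exact ⟨b, mem_insert_of_mem a hb, hpb⟩
    obtain ⟨a, ha, hpa⟩ := key F hF hFp
    exact hsF ⟨a, ha, sSup_le hpa⟩
  refine ⟨sSup (p : Set M)ᶜ, Set.ext fun y ↦ ⟨fun hy hle ↦ hmem ?_, fun hy ↦ ?_⟩⟩
  · exact IsUpper.isUpperSet_of_isOpen p.isOpen hle hy
  · by_contra hyp
    exact hy (le_sSup hyp)

/-- Expresses membership of a point through the order on open sets, so that lattice isomorphisms can
transport it. -/
theorem le_compl_Iic_iff {M : Type*} [PartialOrder M] [TopologicalSpace M] [ClosedIicTopology M]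
    (hup : ∀ O : Set M, IsOpen O → IsUpperSet O) {O : Opens M} {x : M} :
    O ≤ ⟨(Iic x)ᶜ, isClosed_Iic.isOpen_compl⟩ ↔ x ∉ O :=
  ⟨fun h hx ↦ h hx le_rfl, fun hx _ hy hyx ↦ hx (hup O O.isOpen hyx hy)⟩

theorem infPrime_compl_Iic {M : Type*} [PartialOrder M] [TopologicalSpace M] [ClosedIicTopology M]
    (hup : ∀ O : Set M, IsOpen O → IsUpperSet O) (x : M) :
    InfPrime (⟨(Iic x)ᶜ, isClosed_Iic.isOpen_compl⟩ : Opens M) := by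
  refine ⟨fun h ↦ ?_, fun b c hbc ↦ ?_⟩
  · exact (le_compl_Iic_iff hup).1 (h (le_top : _ ≤ (⊤ : Opens M))) trivial
  · simp only [le_compl_Iic_iff hup] at hbc ⊢
    by_contra! H
    exact hbc ⟨H.1, H.2⟩

theorem infPrime_map {α β : Type*} [SemilatticeInf α] [SemilatticeInf β] (e : α ≃o β) {a : α}
    (h : InfPrime a) : InfPrime (e a) := by
  refine ⟨fun hm ↦ h.1 ((e.isMax_apply).1 hm), fun b c hbc ↦ ?_⟩
  have := @h.2 (e.symm b) (e.symm c) (by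
    rw [← e.symm.map_inf]
    exact e.symm_apply_le.2 hbc)
  simpa only [e.symm_apply_le] using this

/-- For sober spaces whose order is the specialization order, an isomorphism of the lattices of
open sets comes from an isomorphism of the spaces. -/
theorem exists_orderIso_of_opens_orderIso {M N : Type*} [PartialOrder M] [TopologicalSpace M]
    [ClosedIicTopology M] [PartialOrder N] [TopologicalSpace N] [ClosedIicTopology N]
    (hM : ∀ O : Set M, IsOpen O → IsUpperSet O) (hN : ∀ O : Set N, IsOpen O → IsUpperSet O)
    (pM : ∀ p : Opens M, InfPrime p → ∃ x, (p : Set M) = (Iic x)ᶜ)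
    (pN : ∀ p : Opens N, InfPrime p → ∃ x, (p : Set N) = (Iic x)ᶜ)
    (e : Opens M ≃o Opens N) : ∃ f : M ≃o N, ∀ O x, x ∈ O ↔ f x ∈ e O := by
  have h1 : ∀ x : M, ∃ y : N, e ⟨(Iic x)ᶜ, isClosed_Iic.isOpen_compl⟩ =
      ⟨(Iic y)ᶜ, isClosed_Iic.isOpen_compl⟩ := fun x ↦ by
    obtain ⟨y, hy⟩ := pN _ (infPrime_map e (infPrime_compl_Iic hM x))
    exact ⟨y, Opens.ext hy⟩
  choose f hf using h1
  have hmem : ∀ O x, x ∈ O ↔ f x ∈ e O := fun O x ↦ by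
    rw [← not_iff_not, ← le_compl_Iic_iff hM, ← le_compl_Iic_iff hN, ← hf, e.le_iff_le]
  have hle : ∀ {a b}, f a ≤ f b ↔ a ≤ b := by
    intro a b
    have := hmem ⟨(Iic b)ᶜ, isClosed_Iic.isOpen_compl⟩ a
    rw [hf] at this
    exact (not_iff_not.1 this).symm
  have hsurj : Function.Surjective f := fun y ↦ by
    obtain ⟨x, hx⟩ := pM _ (infPrime_map e.symm (infPrime_compl_Iic hN y))
    refine ⟨x, ?_⟩
    have hx' : e.symm ⟨(Iic y)ᶜ, isClosed_Iic.isOpen_compl⟩ =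
      ⟨(Iic x)ᶜ, isClosed_Iic.isOpen_compl⟩ := Opens.ext hx
    have := hf x
    rw [← hx', e.apply_symm_apply] at this
    exact (Iic_injective (compl_injective (congrArg (fun O : Opens N ↦ (O : Set N)) this))).symm
  exact ⟨RelIso.ofSurjective (OrderEmbedding.ofMapLEIff f fun _ _ ↦ hle) hsurj, hmem⟩

end Sober

/-! ### The equivalence of the three conditions -/

section Equivalence

theorem isOpen_induced_toDual {L : Type*} {t : TopologicalSpace Lᵒᵈ} {s : Set L} :
    IsOpen[t.induced OrderDual.toDual] s ↔ IsOpen[t] (OrderDual.ofDual ⁻¹' s) :=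
  ⟨fun ⟨u, hu, hs⟩ ↦ by subst hs; exact hu, fun h ↦ ⟨_, h, rfl⟩⟩

variable {L : Type*} [CompleteLattice L]

theorem induced_toDual_upper (L : Type*) [CompleteLattice L] :
    (upperTopology Lᵒᵈ).induced OrderDual.toDual = Topology.lower L := by
  rw [upperTopology, Topology.upper, induced_generateFrom_eq, Topology.lower]
  congr 1
  ext s
  constructor
  · rintro ⟨_, ⟨a, rfl⟩, rfl⟩
    exact ⟨OrderDual.ofDual a, rfl⟩
  · rintro ⟨a, rfl⟩
    exact ⟨_, ⟨OrderDual.toDual a, rfl⟩, rfl⟩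

theorem isOpen_lower_iff {s : Set L} :
    IsOpen[Topology.lower L] s ↔ IsOpen[upperTopology Lᵒᵈ] (OrderDual.ofDual ⁻¹' s) := by
  rw [← induced_toDual_upper, isOpen_induced_toDual]

/-- In a continuous lattice, complementation identifies the open sets of the upper topology of the
opposite lattice with the Scott compact saturated sets. -/
def IsContinuousPoset.opensUpperDualIso (hL : IsContinuousPoset L) :
    @Opens Lᵒᵈ (upperTopology Lᵒᵈ) ≃o ScottCompactSaturated L where
  toFun := letI := upperTopology Lᵒᵈ; fun O ↦ OrderDual.toDual ⟨(OrderDual.toDual ⁻¹' O.1)ᶜ, hL.isClosed_lower_iff.1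
    ((@isClosed_compl_iff L (Topology.lower L) _).2 (isOpen_lower_iff.2 O.2))⟩
  invFun := letI := upperTopology Lᵒᵈ; fun K ↦ ⟨OrderDual.ofDual ⁻¹' ((OrderDual.ofDual K).1)ᶜ, isOpen_lower_iff.1
    ((@isOpen_compl_iff L _ (Topology.lower L)).2 (hL.isClosed_lower_iff.2 (OrderDual.ofDual K).2))⟩
  left_inv O := by
    let _ := upperTopology Lᵒᵈ
    refine Opens.ext ?_
    exact compl_compl O.1
  right_inv K := by
    refine congrArg OrderDual.toDual (Subtype.ext ?_)
    exact compl_compl (OrderDual.ofDual K).1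
  map_rel_iff' := by
    let _ := upperTopology Lᵒᵈ
    intro O O'
    exact (compl_subset_compl : (O' : Set Lᵒᵈ)ᶜ ⊆ (O : Set Lᵒᵈ)ᶜ ↔ (O : Set Lᵒᵈ) ⊆ O')

theorem IsContinuousPoset.lawson_of_scott_eq_upper (hL : IsContinuousPoset L)
    (h : scottTopology Lᵒᵈ = upperTopology Lᵒᵈ) :
    @CompactSpace L (biScottTopology L) ∧ @T2Space L (biScottTopology L) := by
  have : biScottTopology L = lawsonTopology L := by
    rw [biScottTopology, h, induced_toDual_upper]
  rw [this]
  exact ⟨compactSpace_lawson L, hL.t2Space_lawson⟩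

theorem IsContinuousPoset.scott_eq_upper_of_compactSpace (hL : IsContinuousPoset L)
    (h : @CompactSpace L (biScottTopology L)) : scottTopology Lᵒᵈ = upperTopology Lᵒᵈ := by
  refine le_antisymm (scott_le_upper _) fun O hO ↦ ?_
  have hle : biScottTopology L ≤ lawsonTopology L := by
    refine inf_le_inf_left _ ?_
    rw [← induced_toDual_upper]
    exact induced_mono (scott_le_upper _)
  have hO' : IsOpen[biScottTopology L] (OrderDual.toDual ⁻¹' O) :=
    (inf_le_right : biScottTopology L ≤ _) _ (isOpen_induced_toDual.2 hO)
  have hclosed : IsClosed[lawsonTopology L] (OrderDual.toDual ⁻¹' O)ᶜ := by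
    have := @Continuous.isClosedMap L L (biScottTopology L) (lawsonTopology L) h hL.t2Space_lawson
      id (continuous_id_iff_le.2 hle) _ ((@isClosed_compl_iff L (biScottTopology L) _).2 hO')
    rwa [image_id] at this
  have hup : IsUpperSet (OrderDual.toDual ⁻¹' O)ᶜ := fun a b hab ha hb ↦
    ha ((isOpen_scott_iff.1 hO).1 (OrderDual.toDual_le_toDual.2 hab) hb)
  have := hL.isClosed_lower_iff.2 ⟨isCompact_scott_of_isClosed_lawson hclosed, hup⟩
  exact isOpen_lower_iff.1 ((@isClosed_compl_iff L (Topology.lower L) _).1 this)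

theorem isCompact_upper_dual_of_isClosed_scott {C : Set L} (hC : IsClosed[scottTopology L] C) :
    @IsCompact Lᵒᵈ (upperTopology Lᵒᵈ) (OrderDual.ofDual ⁻¹' C) := by
  have h : @IsCompact L (lawsonTopology L) C :=
    @IsClosed.isCompact L (lawsonTopology L) C (compactSpace_lawson L) (hC.mono inf_le_left)
  have := @IsCompact.image L Lᵒᵈ (lawsonTopology L) (upperTopology Lᵒᵈ) C OrderDual.toDual h
    (continuous_iff_le_induced.2 (inf_le_right.trans (induced_toDual_upper L).ge))
  rwa [← OrderDual.ofDual_symm_eq, Equiv.image_symm_eq_preimage] at this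

/-- The lattice of open sets of the upper topology of the opposite of a continuous lattice is
continuous, witnessed by Scott open families. -/
theorem IsContinuousPoset.exists_scottOpen_family (hL : IsContinuousPoset L)
    (O : @Opens Lᵒᵈ (upperTopology Lᵒᵈ)) {x : Lᵒᵈ} (hx : x ∈ O) :
    ∃ V : @Opens Lᵒᵈ (upperTopology Lᵒᵈ), x ∈ V ∧ ∃ H : Set (@Opens Lᵒᵈ (upperTopology Lᵒᵈ)),
      O ∈ H ∧ (∀ O' ∈ H, V ≤ O') ∧ IsUpperSet H ∧ DirSupInacc H := by
  let _ := upperTopology Lᵒᵈ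
  have hK := hL.isClosed_lower_iff.1
    ((@isClosed_compl_iff L (Topology.lower L) _).2 (isOpen_lower_iff.2 O.2))
  obtain ⟨V, U, hV, hU, hxV, hVU, hKU⟩ :=
    hL.exists_separation hK.1 hK.2 (x := OrderDual.ofDual x) (not_not.2 hx)
  have hC := isCompact_upper_dual_of_isClosed_scott
    ((@isClosed_compl_iff L (scottTopology L) _).2 hU)
  -- The compact set `Uᶜ` is interpolated between `V` and `O`; its compactness makes the family of
  -- its open neighbourhoods Scott open.
  refine ⟨⟨OrderDual.ofDual ⁻¹' V, isOpen_lower_iff.1 hV⟩, hxV,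
    {O' | OrderDual.ofDual ⁻¹' Uᶜ ⊆ (O' : Set Lᵒᵈ)}, ?_, ?_, ?_, ?_⟩
  · intro z hz
    by_contra hzO
    exact hz (hKU hzO)
  · exact fun O' hO' z hz ↦ hO' (disjoint_left.1 hVU hz)
  · exact fun O₁ O₂ h12 h1 ↦ Subset.trans h1 h12
  · intro D hD hd s hs hsH
    have := hD.to_subtype
    obtain ⟨⟨i, hi⟩, hiC⟩ := hC.elim_directed_cover (fun i : D ↦ (i.1 : Set Lᵒᵈ))
      (fun i ↦ i.1.isOpen) (fun z hz ↦ by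
        have hzs : z ∈ s := hsH hz
        rw [← hs.sSup_eq, Opens.mem_sSup] at hzs
        obtain ⟨i, hi, hzi⟩ := hzs
        exact mem_iUnion.2 ⟨⟨i, hi⟩, hzi⟩)
      (fun i j ↦ by
        obtain ⟨k, hk, hik, hjk⟩ := hd i.1 i.2 j.1 j.2
        exact ⟨⟨k, hk⟩, hik, hjk⟩)
    exact ⟨i, hi, hiC⟩

theorem dirSupInacc_preimage {α β : Type*} [PartialOrder α] [PartialOrder β] (e : α ≃o β)
    {H : Set β} (h : DirSupInacc H) : DirSupInacc (e ⁻¹' H) := by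
  intro D hD hd s hs hsH
  obtain ⟨_, ⟨i, hi, rfl⟩, hiH⟩ := h (hD.image e)
    (directedOn_image.2 (hd.mono' fun _ _ _ _ hab ↦ e.monotone hab)) (e.isLUB_image'.2 hs) hsH
  exact ⟨i, hi, hiH⟩

theorem IsContinuousPoset.scott_eq_upper_of_orderIso (hL : IsContinuousPoset L)
    (e : ScottOpens Lᵒᵈ ≃o @Opens Lᵒᵈ (upperTopology Lᵒᵈ)) :
    scottTopology Lᵒᵈ = upperTopology Lᵒᵈ := by
  have hs : @IsScott Lᵒᵈ univ _ (scottTopology Lᵒᵈ) := @IsScott.mk _ _ _ (scottTopology Lᵒᵈ) rfl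
  have hu : @IsUpper Lᵒᵈ (upperTopology Lᵒᵈ) _ := @IsUpper.mk _ (upperTopology Lᵒᵈ) _ rfl
  have family : ∀ O : ScottOpens Lᵒᵈ, ∀ b ∈ O, ∃ V : ScottOpens Lᵒᵈ, b ∈ V ∧
      ∃ H : Set (ScottOpens Lᵒᵈ), O ∈ H ∧ (∀ O' ∈ H, V ≤ O') ∧ IsUpperSet H ∧ DirSupInacc H := by
    intro O b hb
    let S : Set (@Opens Lᵒᵈ (upperTopology Lᵒᵈ)) := {V | ∃ H, e O ∈ H ∧ (∀ O' ∈ H, V ≤ O') ∧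
      IsUpperSet H ∧ DirSupInacc H}
    have hS : e O = sSup S := by
      refine le_antisymm (fun x hx ↦ ?_) (sSup_le fun V ⟨H, hOH, hVH, _⟩ ↦ hVH _ hOH)
      obtain ⟨V, hxV, hV⟩ := hL.exists_scottOpen_family (e O) hx
      exact (@Opens.mem_sSup Lᵒᵈ (upperTopology Lᵒᵈ) _ _).2 ⟨V, hV, hxV⟩
    have hO : O = sSup (e.symm '' S) := by
      rw [sSup_image, ← e.symm.map_sSup, ← hS, e.symm_apply_apply]
    rw [hO] at hb
    obtain ⟨_, ⟨V, ⟨H, hOH, hVH, hHup, hHin⟩, rfl⟩, hbV⟩ :=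
      (@Opens.mem_sSup Lᵒᵈ (scottTopology Lᵒᵈ) _ _).1 hb
    exact ⟨e.symm V, hbV, e ⁻¹' H, hOH, fun O' hO' ↦ e.symm_apply_le.2 (hVH _ hO'),
      hHup.preimage e.monotone, dirSupInacc_preimage e hHin⟩
  obtain ⟨f, hf⟩ := @exists_orderIso_of_opens_orderIso Lᵒᵈ Lᵒᵈ _ (scottTopology Lᵒᵈ)
    (@IsScott.instClosedIicTopologyOfUnivSet _ _ (scottTopology Lᵒᵈ) hs) _ (upperTopology Lᵒᵈ)
    (@IsUpper.instClosedIicTopology _ _ (upperTopology Lᵒᵈ) hu)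
    (fun _ hO ↦ (isOpen_scott_iff.1 hO).1)
    (fun _ hO ↦ @IsUpper.isUpperSet_of_isOpen _ _ (upperTopology Lᵒᵈ) hu _ hO)
    (fun p hp ↦ @exists_eq_compl_Iic_of_infPrime_scott _ _ (scottTopology Lᵒᵈ) hs family p hp)
    (fun p hp ↦ @exists_eq_compl_Iic_of_infPrime_upper _ _ (upperTopology Lᵒᵈ) hu p hp) e
  refine le_antisymm (scott_le_upper _) fun O hO ↦ ?_
  let O' : ScottOpens Lᵒᵈ := @Opens.mk Lᵒᵈ (scottTopology Lᵒᵈ) O hO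
  let _ := upperTopology Lᵒᵈ
  have hOf : O = f ⁻¹' (e O').1 := Set.ext fun x ↦ hf O' x
  -- Order isomorphisms pull principal ideals back to principal ideals.
  have hcont : Continuous f := by
    refine IsUpper.continuous_iff_Iic.2 fun a ↦ ?_
    have : f ⁻¹' Iic a = Iic (f.symm a) := Set.ext fun x ↦ f.le_symm_apply.symm
    rw [this]
    exact isClosed_Iic
  rw [hOf]
  exact (e O').2.preimage hcont

end Equivalence

end BiScott

theorem mainTheorem5 {L : Type*} [CompleteLattice L] (hL : BiScott.IsContinuousPoset L) :
    List.TFAE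
      [BiScott.scottTopology Lᵒᵈ = BiScott.upperTopology Lᵒᵈ,
        @CompactSpace L (BiScott.biScottTopology L) ∧ @T2Space L (BiScott.biScottTopology L),
        Nonempty (BiScott.ScottOpens Lᵒᵈ ≃o BiScott.ScottCompactSaturated L)] := by
  tfae_have 1 → 2 := hL.lawson_of_scott_eq_upper
  tfae_have 2 → 1 := fun h ↦ hL.scott_eq_upper_of_compactSpace h.1
  tfae_have 1 → 3 := fun h ↦ by
    unfold BiScott.ScottOpens
    rw [h]
    exact ⟨hL.opensUpperDualIso⟩
  tfae_have 3 → 1 := fun ⟨e⟩ ↦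
    hL.scott_eq_upper_of_orderIso (e.trans hL.opensUpperDualIso.symm)
  tfae_finish
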